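/- Let $h$ be the morphism $1\mapsto 110$, $0\mapsto 11$ on binary words, let $K_n=h^n(1)$ and $\mathcal K_n=|K_n|$ (so $\mathcal K_0=1$, $\mathcal K_1=3$, $\mathcal K_n=2\mathcal K_{n-1}+2\mathcal K_{n-2}$), and let $\mathbf k=k_1k_2k_3\cdots=1101101111\cdots$ be the infinite word of which every $K_n$ is a prefix. For a word of digits $a_t\cdots a_0$ with $a_i\in\{0,1,2\}$ put $[a_t\cdots a_0]_K=\sum_{0\le i\le t}a_i\mathcal K_i$. A period of a finite word $x=x_1\cdots x_n$ is an integer $p\ge1$ with $x_i=x_{i+p}$ for $1\le i\le n-p$; the exponent of a nonempty finite word is its length divided by its least period; and the critical exponent of an infinite word is the supremum of the exponents of its finite nonempty factors. The critical exponent of $\mathbf k$ is $(2\sqrt3+12)/3\doteq 5.1547$. Moreover, let $n,p$ be natural numbers. Then $n$ is the largest length of a nonempty factor of $\mathbf k$ with least period $p$, and $n\ge 5p$, if and only if one of the following holds: $(n,p)=([1202]_K,[100]_K)=(40,8)$, of exponent exactly $5$; or, for some $i\ge0$, $(n,p)=([121(01)^i00]_K,[10(00)^i00]_K)$; or, for some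 $i\ge0$, $(n,p)=([121(01)^i002]_K,[10(00)^i000]_K)$. -/

import Mathlib

namespace Kimberling

/-- The image of a letter under the morphism `h : 1 ↦ 110, 0 ↦ 11`. -/
def hLetter (a : Fin 2) : List (Fin 2) := if a = 1 then [1, 1, 0] else [1, 1]

/-- The morphism `h` on finite words. -/
def h (w : List (Fin 2)) : List (Fin 2) := w.flatMap hLetter

/-- The finite word `K_n = h^n(1)`. -/
def K (n : ℕ) : List (Fin 2) := h^[n] [1]

/-- The integer `𝒦_n = |K_n|`. -/
def Kcal (n : ℕ) : ℕ := (K n).length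

theorem K_succ (n : ℕ) : K (n + 1) = h (K n) := Function.iterate_succ_apply' h n [1]

theorem K_prefix_succ (n : ℕ) : K n <+: K (n + 1) := by
  induction n with
  | zero => exact ⟨[1, 0], rfl⟩
  | succ n ih =>
    obtain ⟨t, ht⟩ := ih
    refine ⟨h t, ?_⟩
    calc K (n + 1) ++ h t = h (K n) ++ h t := by rw [K_succ n]
      _ = h (K n ++ t) := by simp [h]
      _ = K (n + 1 + 1) := by rw [ht, K_succ (n + 1)]

theorem K_prefix {m n : ℕ} (hmn : m ≤ n) : K m <+: K n := by
  induction n, hmn using Nat.le_induction with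
  | base => exact List.prefix_rfl
  | succ n _ ih => exact ih.trans (K_prefix_succ n)

theorem two_mul_length_le (w : List (Fin 2)) : 2 * w.length ≤ (h w).length := by
  induction w with
  | nil => simp
  | cons a w ih =>
    have ha : 2 ≤ (hLetter a).length := by
      unfold hLetter
      split <;> simp
    simp only [h, List.flatMap_cons, List.length_append, List.length_cons] at ih ⊢
    omega

theorem lt_length_K (n : ℕ) : n < (K n).length := by
  induction n with
  | zero => simp [K]
  | succ n ih =>
    have := two_mul_length_le (K n)
    rw [K_succ]
    omega

/-- The infinite word `𝐤 = k_1 k_2 k_3 ⋯`, the limit of the words `K_n`. As for every infinite word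
below, the letters are stored from index `0` on: `word n` is the letter `k_{n+1}`. -/
def word (n : ℕ) : Fin 2 := (K n)[n]'(lt_length_K n)

/-- Every `K_n` is a prefix of `𝐤`, which determines `𝐤`. -/
theorem word_eq {n j : ℕ} (hj : j < (K n).length) : word j = (K n)[j] := by
  rcases le_total j n with hjn | hnj
  · exact (K_prefix hjn).getElem (lt_length_K j)
  · exact ((K_prefix hnj).getElem hj).symm

/-- The value `[a_t ⋯ a_0]_K = ∑ a_i 𝒦_i` of a word of digits, most significant digit first. -/
def val : List ℕ → ℕ
  | [] => 0
  | a :: w => a * Kcal w.length + val w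

/-- The finite word `x` is a factor (a block of consecutive letters) of the infinite word `z`. -/
def IsFactor {A : Type*} (z : ℕ → A) (x : List A) : Prop :=
  ∃ i : ℕ, x = (List.range x.length).map (fun j => z (i + j))

/-- `p ≥ 1` is a period of the finite word `x`. -/
def IsPeriod {A : Type*} (x : List A) (p : ℕ) : Prop :=
  1 ≤ p ∧ ∀ i : ℕ, ∀ hi : i + p < x.length, x[i] = x[i + p]

/-- The shortest period of a finite word. -/
noncomputable def leastPeriod {A : Type*} (x : List A) : ℕ := sInf {p : ℕ | IsPeriod x p}

/-- Every finite word has a period, so that `leastPeriod x` is one. -/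
theorem isPeriod_leastPeriod {A : Type*} (x : List A) : IsPeriod x (leastPeriod x) :=
  Nat.sInf_mem (s := {p : ℕ | IsPeriod x p})
    ⟨x.length + 1, by omega, fun i hi => absurd hi (by omega)⟩

/-- The exponent of a finite word: its length divided by its shortest period. -/
noncomputable def exponent {A : Type*} (x : List A) : ℝ := (x.length : ℝ) / (leastPeriod x : ℝ)

/-- `e` is the critical exponent of the infinite word `z`: the supremum of the exponents of its
finite nonempty factors. -/
def IsCriticalExponent {A : Type*} (z : ℕ → A) (e : ℝ) : Prop :=
  IsLUB {r : ℝ | ∃ x : List A, x ≠ [] ∧ IsFactor z x ∧ exponent x = r} e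

/-- `n` is the length of the longest nonempty factors of `z` that have shortest period `p`. -/
def IsMaxLength {A : Type*} (z : ℕ → A) (n p : ℕ) : Prop :=
  IsGreatest {m : ℕ | ∃ x : List A, x ≠ [] ∧ IsFactor z x ∧ leastPeriod x = p ∧ x.length = m} n

/-- The word `u^i`. -/
def pow (u : List ℕ) (i : ℕ) : List ℕ := (List.replicate i u).flatten

end Kimberling

namespace Kimberling

/-! ### The fixed point structure of the word -/

/-! The word is fixed by `h`. The letter `0` occurs only at the end of an image `h(1) = 110`, so any
zero in a run of period `p` reveals the cutting into images, and the run desubstitutes to a run of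
smaller period (`Run.exists_preimage`). Conversely, taking images extends a run by exactly two
letters on the right, since `110` and `11` share the prefix `11`, and by none on the left, since
their last letters differ. Descent ends at a run in a block of ones, and blocks of ones have length
at most 4. If the exponent is at least 5, the base period must be that of a single letter `1`
(`Run.le_maxLen`). The block `1111` is optimal: its `m`-fold image has period `𝒦_m` and, with the
extensions, length `4𝒦_m + 2(𝒦_0 + ⋯ + 𝒦_{m-1})`, which is `maxLen m`. The exponent reaches 5 from
`m = 2` on. As the sum is `𝒦_m/√3` up to a bounded error, the exponents stay below `4 + 2/√3` and
tend to it. -/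

theorem h_append (u v : List (Fin 2)) : h (u ++ v) = h u ++ h v := by simp [h]

theorem length_hLetter (a : Fin 2) : (hLetter a).length = if a = 1 then 3 else 2 := by
  unfold hLetter
  split <;> rfl

/-- The position in the word at which the image of the letter number `t` starts. -/
def start : ℕ → ℕ
  | 0 => 0
  | t + 1 => start t + (hLetter (word t)).length

theorem length_h_take (n t : ℕ) (ht : t ≤ (K n).length) :
    (h ((K n).take t)).length = start t := by
  induction t with
  | zero => simp [h, start]
  | succ t ih =>
    rw [List.take_succ_eq_append_getElem (by omega), h_append, List.length_append,
      ih (by omega), start, word_eq (n := n) (j := t) (by omega)]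
    simp [h]

theorem word_start_add (t r : ℕ) (hr : r < (hLetter (word t)).length) :
    word (start t + r) = (hLetter (word t))[r] := by
  have ht : t < (K t).length := lt_length_K t
  have hK : K (t + 1) = h ((K t).take t) ++ (hLetter (word t) ++ h ((K t).drop (t + 1))) := by
    rw [K_succ]
    conv_lhs => rw [← List.take_append_drop t (K t), h_append, List.drop_eq_getElem_cons ht]
    simp only [h, word, List.flatMap_cons]
  have hl : (h ((K t).take t)).length = start t := length_h_take t t ht.le
  have hlt : start t + r < (K (t + 1)).length := by
    rw [hK, List.length_append, List.length_append, hl]; omega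
  rw [word_eq hlt]
  simp only [hK]
  rw [List.getElem_append_right (by omega), List.getElem_append_left (by omega)]
  simp [hl]

theorem eq_zero_or_one (a : Fin 2) : a = 0 ∨ a = 1 := by omega

theorem start_succ_of_one {t : ℕ} (ht : word t = 1) : start (t + 1) = start t + 3 := by
  rw [start, ht]; rfl

theorem start_succ_of_zero {t : ℕ} (ht : word t = 0) : start (t + 1) = start t + 2 := by
  rw [start, ht]; rfl

theorem word_start (t : ℕ) : word (start t) = 1 := by
  have := word_start_add t 0 (by rw [length_hLetter]; split <;> omega)
  rw [add_zero] at this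
  rw [this]
  unfold hLetter
  split <;> rfl

theorem word_start_add_one (t : ℕ) : word (start t + 1) = 1 := by
  rw [word_start_add t 1 (by rw [length_hLetter]; split <;> omega)]
  unfold hLetter
  split <;> rfl

theorem word_start_add_two_of_one {t : ℕ} (ht : word t = 1) : word (start t + 2) = 0 := by
  rw [word_start_add t 2 (by rw [ht]; decide)]
  simp [ht, hLetter]

theorem word_start_add_two_of_zero {t : ℕ} (ht : word t = 0) : word (start t + 2) = 1 := by
  rw [← start_succ_of_zero ht, word_start]

theorem start_succ_ge (t : ℕ) : start t + 2 ≤ start (t + 1) := by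
  rcases eq_zero_or_one (word t) with ht | ht
  · rw [start_succ_of_zero ht]
  · rw [start_succ_of_one ht]; omega

theorem start_strictMono : StrictMono start :=
  strictMono_nat_of_lt_succ fun t => by have := start_succ_ge t; omega

theorem start_add_ge (t d : ℕ) : start t + 2 * d ≤ start (t + d) := by
  induction d with
  | zero => simp
  | succ d ih =>
    have := start_succ_ge (t + d)
    rw [← add_assoc]
    omega

/-- Every position lies in the image of exactly one letter. -/
theorem exists_start_add (x : ℕ) : ∃ t r, x = start t + r ∧ start t + r < start (t + 1) := by
  induction x with
  | zero => exact ⟨0, 0, rfl, start_strictMono (Nat.lt_succ_self 0)⟩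
  | succ x ih =>
    obtain ⟨t, r, rfl, hr⟩ := ih
    by_cases hlt : start t + (r + 1) < start (t + 1)
    · exact ⟨t, r + 1, rfl, hlt⟩
    · exact ⟨t + 1, 0, by omega, start_strictMono (Nat.lt_succ_self _)⟩

/-- Synchronisation: a `0` marks the end of an image, so a new image starts right after it. -/
theorem exists_of_word_eq_zero {q : ℕ} (hq : word q = 0) :
    ∃ s, q + 1 = start (s + 1) := by
  obtain ⟨t, r, rfl, hr⟩ := exists_start_add q
  have h0 := word_start t
  have h1 := word_start_add_one t
  rcases eq_zero_or_one (word t) with ht | ht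
  · rw [start_succ_of_zero ht] at hr
    obtain rfl | rfl : r = 0 ∨ r = 1 := by omega
    · rw [add_zero, h0] at hq; exact absurd hq (by decide)
    · rw [h1] at hq; exact absurd hq (by decide)
  · refine ⟨t, ?_⟩
    rw [start_succ_of_one ht] at hr ⊢
    obtain rfl | rfl | rfl : r = 0 ∨ r = 1 ∨ r = 2 := by omega
    · rw [add_zero, h0] at hq; exact absurd hq (by decide)
    · rw [h1] at hq; exact absurd hq (by decide)
    · rfl

theorem word_succ_of_zero {q : ℕ} (hq : word q = 0) : word (q + 1) = 1 := by
  obtain ⟨s, hs⟩ := exists_of_word_eq_zero hq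
  rw [hs, word_start]

theorem exists_zero_lt_five (x : ℕ) : ∃ d < 5, word (x + d) = 0 := by
  obtain ⟨t, r, rfl, hr⟩ := exists_start_add x
  rcases eq_zero_or_one (word t) with ht | ht
  -- An image `11` of `0` is followed by `110`, because `00` does not occur.
  · have h1 := word_start_add_two_of_one (word_succ_of_zero ht)
    rw [start_succ_of_zero ht] at hr h1
    exact ⟨4 - r, by omega, by rw [← h1]; congr 1; omega⟩
  · rw [start_succ_of_one ht] at hr
    exact ⟨2 - r, by omega, by rw [← word_start_add_two_of_one ht]; congr 1; omega⟩

/-- The last letter of the image of a letter determines the letter. -/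
theorem word_eq_of_last_eq {s t : ℕ}
    (hst : word (start (s + 1) - 1) = word (start (t + 1) - 1)) : word s = word t := by
  have key : ∀ u, word (start (u + 1) - 1) = 1 - word u := by
    intro u
    rcases eq_zero_or_one (word u) with hu | hu
    · rw [start_succ_of_zero hu, hu]; exact word_start_add_one u
    · rw [start_succ_of_one hu, hu]; exact word_start_add_two_of_one hu
  rw [key, key] at hst
  exact sub_right_injective hst

/-- The letter following the first two letters of an image determines the letter. -/
theorem word_eq_of_third_eq {s t : ℕ}
    (hst : word (start s + 2) = word (start t + 2)) : word s = word t := by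
  have key : ∀ u, word (start u + 2) = 1 - word u := by
    intro u
    rcases eq_zero_or_one (word u) with hu | hu
    · rw [word_start_add_two_of_zero hu, hu]; rfl
    · rw [word_start_add_two_of_one hu, hu]; rfl
  rw [key, key] at hst
  exact sub_right_injective hst

/-! ### Runs and their images -/

/-- The block of the word between `i` and `j + p` has period `p`. -/
def Run (i j p : ℕ) : Prop := ∀ x, i ≤ x → x < j → word x = word (x + p)

/-- A run of period `p` starting at `i` cannot be extended to the left. -/
def LeftMaximal (i p : ℕ) : Prop := ∀ x, x + 1 = i → word x ≠ word (x + p)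

/-- Positions `t` and `t + p` carry equal letters along the run, so both starts advance by the same
amount. -/
theorem Run.start_add {i j p : ℕ} (hrun : Run i j p) {t : ℕ} (hit : i ≤ t) (htj : t ≤ j) :
    start (t + p) + start i = start (i + p) + start t := by
  induction t, hit using Nat.le_induction with
  | base => omega
  | succ t hit ih =>
    have ih := ih (by omega)
    have hw := hrun t hit (by omega)
    have e : t + 1 + p = t + p + 1 := by omega
    rw [e, start, start, ← hw]
    omega

theorem Run.image {i j p P : ℕ} (hij : i ≤ j) (hrun : Run i j p)
    (hP : start (i + p) = start i + P) : Run (start i) (start j + 2) P := by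
  have sync : ∀ t, i ≤ t → t ≤ j → start (t + p) = start t + P := by
    intro t hit htj
    have := hrun.start_add hit htj
    omega
  intro x hix hxj
  obtain ⟨t, r, rfl, hr⟩ := exists_start_add x
  have hit : i ≤ t := by
    by_contra hlt
    have := start_strictMono.monotone (show t + 1 ≤ i by omega)
    omega
  have htj : t ≤ j := by
    by_contra hlt
    have := start_strictMono.monotone (show j + 1 ≤ t by omega)
    have := start_succ_ge j
    omega
  rw [show start t + r + P = start (t + p) + r by rw [sync t hit htj]; omega]
  rcases htj.eq_or_lt with rfl | htj
  · obtain rfl | rfl : r = 0 ∨ r = 1 := by omega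
    · simp [word_start]
    · simp [word_start_add_one]
  · have hw := hrun t hit htj
    have hr' : r < (hLetter (word t)).length := by rw [start] at hr; omega
    rw [word_start_add t r hr', word_start_add (t + p) r (by rw [← hw]; exact hr')]
    simp only [← hw]

/-- A run that contains the letter `0` is the image of a run of smaller period. -/
theorem Run.exists_preimage {i j p : ℕ} (hp : 1 ≤ p) (hrun : Run i j p)
    (hmax : LeftMaximal i p) (hzero : ∃ q, i ≤ q ∧ q < j ∧ word q = 0) :
    ∃ i' j' p', 1 ≤ p' ∧ p' < p ∧ i' ≤ j' ∧ Run i' j' p' ∧ LeftMaximal i' p' ∧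
      i = start i' ∧ i + p = start (i' + p') ∧ j ≤ start j' + 2 := by
  classical
  obtain ⟨q, hiq, hqj, hq⟩ := hzero
  obtain ⟨s, hs⟩ := exists_of_word_eq_zero hq
  obtain ⟨s', hs'⟩ := exists_of_word_eq_zero ((hrun q hiq hqj) ▸ hq)
  have hss : s + 1 < s' + 1 := start_strictMono.lt_iff_lt.1 (by omega)
  obtain ⟨p', hp'⟩ := Nat.exists_eq_add_of_lt hss
  -- The zeros at `q` and `q + p` both end images; the difference `d` of the indices of these images
  -- is the new period.
  obtain ⟨d, rfl⟩ : ∃ d, s' = s + d := ⟨s' - s, by omega⟩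
  generalize hσ : s + 1 = σ at *
  rw [show s + d + 1 = σ + d by omega] at hs' hss
  -- The preimage run grows from the anchor `σ` in both directions. On the right it also stops once
  -- it covers `j`, so that the search terminates even if no mismatch occurs.
  have hexj : ∃ j', σ ≤ j' ∧ (j ≤ start j' ∨ word j' ≠ word (j' + d)) :=
    ⟨σ + j, by omega, Or.inl (by have := start_strictMono.le_apply (x := σ + j); omega)⟩
  have hexi : ∃ a, a ≤ σ ∧ ∀ t, a ≤ t → t < σ → word t = word (t + d) :=
    ⟨σ, le_rfl, fun t h1 h2 => by omega⟩
  obtain ⟨j', ⟨hσj, hj'⟩, hjmin⟩ : ∃ j', (σ ≤ j' ∧ (j ≤ start j' ∨ word j' ≠ word (j' + d))) ∧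
      ∀ t, t < j' → ¬ (σ ≤ t ∧ (j ≤ start t ∨ word t ≠ word (t + d))) :=
    ⟨Nat.find hexj, Nat.find_spec hexj, fun t ht => Nat.find_min hexj ht⟩
  obtain ⟨i', ⟨hiσ, hi'⟩, himin⟩ : ∃ a, (a ≤ σ ∧ ∀ t, a ≤ t → t < σ → word t = word (t + d)) ∧
      ∀ b, b < a → ¬ (b ≤ σ ∧ ∀ t, b ≤ t → t < σ → word t = word (t + d)) :=
    ⟨Nat.find hexi, Nat.find_spec hexi, fun t ht => Nat.find_min hexi ht⟩
  have hrun' : Run i' j' d := by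
    intro x hx1 hx2
    rcases lt_or_ge x σ with hx | hx
    · exact hi' x hx1 hx
    · by_contra hne
      exact hjmin x hx2 ⟨hx, Or.inr hne⟩
  have hmax' : LeftMaximal i' d := by
    intro x hx hw
    refine himin x (by omega) ⟨by omega, fun t ht1 ht2 => ?_⟩
    rcases ht1.eq_or_lt with rfl | ht1
    · exact hw
    · exact hi' t (by omega) ht2
  have hσsync := hrun'.start_add hiσ hσj
  have hisync : start (i' + d) = start i' + p := by omega
  have hjsync : start (j' + d) = start j' + p := by
    have := hrun'.start_add (hiσ.trans hσj) le_rfl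
    omega
  have hmi := start_strictMono.monotone hiσ
  have hmj := start_strictMono.monotone hσj
  have hii : i = start i' := by
    rcases lt_trichotomy i (start i') with hlt | heq | hgt
    · exfalso
      obtain ⟨a, rfl⟩ : ∃ a, i' = a + 1 :=
        Nat.exists_eq_succ_of_ne_zero (by rintro rfl; simp [start] at hlt)
      -- If the run began before `start i'`, the two preceding images would agree in their last
      -- letter, so the preimage run would extend left.
      refine hmax' a rfl (word_eq_of_last_eq ?_)
      rw [hrun (start (a + 1) - 1) (by omega) (by omega),
        show a + d + 1 = a + 1 + d by omega, hisync]
      congr 1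
      omega
    · exact heq
    · exfalso
      refine hmax (i - 1) (by omega) ?_
      exact hrun'.image (hiσ.trans hσj) hisync (i - 1) (by omega) (by omega)
  refine ⟨i', j', d, by omega, ?_, hiσ.trans hσj, hrun', hmax', hii, by omega, ?_⟩
  · have := start_add_ge i' d
    omega
  · rcases hj' with hj' | hj'
    · omega
    · by_contra hlt
      -- A third matching letter past `start j'` would rule out the mismatch at `j'`.
      refine hj' (word_eq_of_third_eq ?_)
      rw [hrun (start j' + 2) (by omega) (by omega), hjsync]
      congr 1
      omega

/-- Every run is an iterated image of a run inside a block of letters `1`. -/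
theorem Run.exists_base {p : ℕ} : ∀ {i j : ℕ}, 1 ≤ p → i ≤ j → Run i j p → LeftMaximal i p →
    ∃ m i' j' p', 1 ≤ p' ∧ i' ≤ j' ∧ Run i' j' p' ∧ (∀ x, i' ≤ x → x < j' → word x = 1) ∧
      i = start^[m] i' ∧ i + p = start^[m] (i' + p') ∧ j ≤ (fun t => start t + 2)^[m] j' := by
  induction p using Nat.strong_induction_on with
  | _ p ih =>
    intro i j hp hij hrun hmax
    by_cases hzero : ∃ q, i ≤ q ∧ q < j ∧ word q = 0
    · obtain ⟨i', j', p', hp1, hpp, hij', hrun', hmax', hi, hip, hj⟩ :=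
        hrun.exists_preimage hp hmax hzero
      obtain ⟨m, a, b, c, hc, hab, hrun'', hone, ha, hac, hb⟩ := ih p' hpp hp1 hij' hrun' hmax'
      refine ⟨m + 1, a, b, c, hc, hab, hrun'', hone, ?_, ?_, ?_⟩
      · rw [Function.iterate_succ_apply', ← ha, hi]
      · rw [Function.iterate_succ_apply', ← hac, hip]
      · rw [Function.iterate_succ_apply']
        have := start_strictMono.monotone hb
        omega
    · refine ⟨0, i, j, p, hp, hij, hrun, fun x hx1 hx2 => ?_, rfl, rfl, le_rfl⟩
      exact (eq_zero_or_one _).resolve_left fun h0 => hzero ⟨x, hx1, hx2, h0⟩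

/-! ### Lengths of iterated images -/

/-- The length of the `m`-fold image of a letter. -/
def blockLen : ℕ → Fin 2 → ℕ
  | 0, _ => 1
  | m + 1, a => 2 * blockLen m 1 + if a = 1 then blockLen m 0 else 0

theorem iterate_start_succ (m t : ℕ) :
    start^[m] (t + 1) = start^[m] t + blockLen m (word t) := by
  induction m generalizing t with
  | zero => simp [blockLen]
  | succ m ih =>
    rw [Function.iterate_succ_apply, Function.iterate_succ_apply]
    have h0 := ih (start t)
    have h1 := ih (start t + 1)
    have h2 := ih (start t + 2)
    rw [word_start] at h0
    rw [word_start_add_one] at h1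
    simp only [add_assoc, Nat.reduceAdd] at h1 h2
    rcases eq_zero_or_one (word t) with ht | ht
    · rw [start_succ_of_zero ht, ht, h1, h0]
      simp [blockLen]
      omega
    · rw [word_start_add_two_of_one ht] at h2
      rw [start_succ_of_one ht, ht, h2, h1, h0]
      simp [blockLen]
      omega

theorem iterate_start_zero (m : ℕ) : start^[m] 0 = 0 := by
  induction m with
  | zero => rfl
  | succ m ih => rw [Function.iterate_succ_apply, start, ih]

theorem start_length_K (n : ℕ) : start (Kcal n) = Kcal (n + 1) := by
  rw [Kcal, ← length_h_take n _ le_rfl, List.take_length, ← K_succ, Kcal]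

theorem Kcal_eq_iterate (m : ℕ) : Kcal m = start^[m] 1 := by
  induction m with
  | zero => rfl
  | succ m ih => rw [Function.iterate_succ_apply', ← ih, start_length_K]

theorem Kcal_eq_blockLen (m : ℕ) : Kcal m = blockLen m 1 := by
  have := iterate_start_succ m 0
  rw [iterate_start_zero, show word 0 = 1 from rfl] at this
  rw [Kcal_eq_iterate]
  simpa using this

theorem Kcal_succ (m : ℕ) : Kcal (m + 1) = 2 * Kcal m + blockLen m 0 := by
  simp [Kcal_eq_blockLen, blockLen]

theorem blockLen_succ_zero (m : ℕ) : blockLen (m + 1) 0 = 2 * Kcal m := by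
  simp [Kcal_eq_blockLen, blockLen]

theorem Kcal_zero : Kcal 0 = 1 := rfl

theorem Kcal_one : Kcal 1 = 3 := rfl

theorem Kcal_add_two (m : ℕ) : Kcal (m + 2) = 2 * Kcal (m + 1) + 2 * Kcal m := by
  rw [Kcal_succ, blockLen_succ_zero]

theorem Kcal_pos (m : ℕ) : 1 ≤ Kcal m := by
  have := lt_length_K m
  rw [Kcal]
  omega

theorem Kcal_strictMono : StrictMono Kcal :=
  strictMono_nat_of_lt_succ fun m => by
    have := Kcal_pos m
    rw [Kcal_succ]
    omega

/-- The sum of the lengths `𝒦_l` for `l < m`. -/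
def Ksum : ℕ → ℕ
  | 0 => 0
  | m + 1 => Ksum m + Kcal m

theorem Ksum_le (m : ℕ) : Ksum m ≤ Kcal m := by
  induction m with
  | zero => simp [Ksum]
  | succ m ih =>
    rw [Ksum, Kcal_succ]
    omega

theorem Ksum_lt_two_mul_blockLen (m : ℕ) : Ksum m < 2 * blockLen m 0 := by
  cases m with
  | zero => simp [Ksum, blockLen]
  | succ m =>
    have := Ksum_le m
    have := Kcal_pos m
    rw [blockLen_succ_zero, Ksum]
    omega

theorem blockLen_zero_le (m : ℕ) : blockLen m 0 ≤ Kcal m := by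
  cases m with
  | zero => simp [Kcal_zero, blockLen]
  | succ m =>
    rw [blockLen_succ_zero, Kcal_succ]
    omega

/-- The recurrence in the form `𝒦_{m+2} - 𝒦_{m+1} = (𝒦_{m+1} - 𝒦_m) + 3𝒦_m` telescopes. -/
theorem Kcal_succ_eq (m : ℕ) : Kcal (m + 1) = 3 * Ksum m + Kcal m + 2 := by
  induction m with
  | zero => rfl
  | succ m ih =>
    rw [Kcal_add_two, Ksum]
    omega

/-- The two ones gained at each level are themselves mapped on by the later levels, contributing
`2𝒦_l` for each `l < m`. -/
theorem iterate_extend (m t : ℕ) :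
    (fun t => start t + 2)^[m] t = start^[m] t + 2 * Ksum m := by
  induction m generalizing t with
  | zero => simp [Ksum]
  | succ m ih =>
    rw [Function.iterate_succ_apply, Function.iterate_succ_apply, ih,
      iterate_start_succ m (start t + 1), iterate_start_succ m (start t), word_start,
      word_start_add_one, Ksum, Kcal_eq_blockLen]
    omega

theorem iterate_start_add_of_one (m : ℕ) {i : ℕ} (k : ℕ)
    (hone : ∀ x, i ≤ x → x < i + k → word x = 1) :
    start^[m] (i + k) = start^[m] i + k * Kcal m := by
  induction k with
  | zero => simp
  | succ k ih =>
    rw [← add_assoc, iterate_start_succ, ih fun x h1 h2 => hone x h1 (by omega),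
      hone (i + k) (by omega) (by omega), ← Kcal_eq_blockLen]
    ring

/-! ### Runs of large exponent -/

/-- The largest length of a factor with least period `𝒦_m`. -/
def maxLen (m : ℕ) : ℕ := 4 * Kcal m + 2 * Ksum m

theorem maxLen_strictMono : StrictMono maxLen :=
  strictMono_nat_of_lt_succ fun m => by
    have := Kcal_strictMono (Nat.lt_succ_self m)
    simp only [maxLen, Ksum, Nat.succ_eq_add_one] at *
    omega

theorem Run.le_maxLen {i j p : ℕ} (hp : 1 ≤ p) (hrun : Run i j p) (hlen : i + 4 * p ≤ j) :
    ∃ m, p = Kcal m ∧ j + p ≤ i + maxLen m := by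
  classical
  have hex : ∃ a, Run a j p := ⟨i, hrun⟩
  obtain ⟨a, ha, hamin⟩ : ∃ a, Run a j p ∧ ∀ b, b < a → ¬ Run b j p :=
    ⟨Nat.find hex, Nat.find_spec hex, fun t ht => Nat.find_min hex ht⟩
  have hai : a ≤ i := not_lt.1 fun hlt => hamin i hlt hrun
  have hmax : LeftMaximal a p := by
    intro x hx hw
    refine hamin x (by omega) fun t ht1 ht2 => ?_
    rcases ht1.eq_or_lt with rfl | ht1
    · exact hw
    · exact ha t (by omega) ht2
  obtain ⟨m, i', j', p', hp', hij', hrun', hone, hi, hip, hj⟩ :=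
    ha.exists_base hp (by omega) hmax
  obtain ⟨k, rfl⟩ := Nat.exists_eq_add_of_le hij'
  rw [iterate_extend, iterate_start_add_of_one m k hone] at hj
  have hk : k ≤ 4 := by
    obtain ⟨d, hd, hd0⟩ := exists_zero_lt_five i'
    by_contra hlt
    rw [hone (i' + d) (by omega) (by omega)] at hd0
    exact absurd hd0 (by decide)
  have hS := Ksum_lt_two_mul_blockLen m
  have hkK : k * Kcal m ≤ 4 * Kcal m := Nat.mul_le_mul_right _ hk
  have hmono : StrictMono start^[m] := start_strictMono.iterate m
  rcases hp'.eq_or_lt with rfl | hp2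
  · rw [iterate_start_succ] at hip
    rcases eq_zero_or_one (word i') with h0 | h1
    · exfalso
      rw [h0] at hip
      -- A base run starting at `0` is empty, so only the extension `2 * Ksum m` remains, too short
      -- for four periods `blockLen m 0`.
      have hk0 : k = 0 := by
        by_contra hne
        rw [hone i' le_rfl (by omega)] at h0
        exact absurd h0 (by decide)
      subst hk0
      omega
    · rw [h1, ← Kcal_eq_blockLen] at hip
      refine ⟨m, by omega, ?_⟩
      -- Here `k` counts equalities between neighbours, so `k = 4` would need five ones.
      have hk3 : k ≤ 3 := by
        by_contra hlt
        have hone' : ∀ x, i' ≤ x → x < i' + 5 → word x = 1 := by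
          intro x hx1 hx2
          rcases Nat.lt_or_ge x (i' + 4) with hx | hx
          · exact hone x hx1 (by omega)
          · obtain rfl : x = i' + 3 + 1 := by omega
            rw [← hrun' (i' + 3) (by omega) (by omega)]
            exact hone _ (by omega) (by omega)
        obtain ⟨d, hd, hd0⟩ := exists_zero_lt_five i'
        rw [hone' (i' + d) (by omega) (by omega)] at hd0
        exact absurd hd0 (by decide)
      have : k * Kcal m ≤ 3 * Kcal m := Nat.mul_le_mul_right _ hk3
      rw [maxLen]
      omega
  · exfalso
    -- The period spans two images, at least one of them of a `1`, so four periods exceed the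
    -- available `4 * Kcal m + 2 * Ksum m`.
    have h2 : start^[m] (i' + 2) ≤ start^[m] (i' + p') := hmono.monotone (by omega)
    have hB := blockLen_zero_le m
    rw [iterate_start_succ m (i' + 1), iterate_start_succ m i'] at h2
    rcases eq_zero_or_one (word i') with h0 | h1
    · rw [word_succ_of_zero h0, h0, ← Kcal_eq_blockLen] at h2
      omega
    · rw [h1, ← Kcal_eq_blockLen] at h2
      rcases eq_zero_or_one (word (i' + 1)) with h0 | h1
      · rw [h0] at h2; omega
      · rw [h1, ← Kcal_eq_blockLen] at h2; omega

theorem exists_run_maxLen (m : ℕ) : ∃ i j, Run i j (Kcal m) ∧ j + Kcal m = i + maxLen m := by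
  -- The first block `1111` occupies the indices 6 to 9.
  have hone : ∀ x, 6 ≤ x → x < 6 + 4 → word x = 1 := by
    intro x h1 h2
    interval_cases x <;> rfl
  have hsync : ∀ m, start^[m] 7 = start^[m] 6 + Kcal m := fun m => by
    rw [iterate_start_succ m 6, hone 6 le_rfl (by omega), ← Kcal_eq_blockLen]
  have key : Run (start^[m] 6) ((fun t => start t + 2)^[m] 9) (Kcal m) ∧
      start^[m] 6 ≤ (fun t => start t + 2)^[m] 9 := by
    induction m with
    | zero =>
      refine ⟨fun x h1 h2 => ?_, by simp⟩
      simp only [Function.iterate_zero, id, Kcal_zero] at *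
      rw [hone x h1 (by omega), hone (x + 1) (by omega) (by omega)]
    | succ m ih =>
      have hs := hsync (m + 1)
      simp only [Function.iterate_succ_apply'] at hs ⊢
      rw [hsync m] at hs
      have := start_strictMono.monotone ih.2
      exact ⟨ih.1.image ih.2 hs, by omega⟩
  have h9 := iterate_start_add_of_one m (i := 6) 3 fun x h1 h2 => hone x h1 (by omega)
  refine ⟨_, _, key.1, ?_⟩
  rw [iterate_extend, h9, maxLen]
  omega

/-! ### Factors -/

/-- The factor of length `n` of the word starting at position `i`. -/
def factor (i n : ℕ) : List (Fin 2) := (List.range n).map fun j => word (i + j)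

theorem length_factor (i n : ℕ) : (factor i n).length = n := by simp [factor]

theorem isFactor_factor (i n : ℕ) : IsFactor word (factor i n) :=
  ⟨i, by rw [length_factor]; rfl⟩

theorem isPeriod_factor_iff {i n p : ℕ} (hpn : p ≤ n) :
    IsPeriod (factor i n) p ↔ 1 ≤ p ∧ Run i (i + (n - p)) p := by
  refine and_congr_right fun _ => ⟨fun hper x hx1 hx2 => ?_, fun hrun x hx => ?_⟩
  · have := hper (x - i) (by rw [length_factor]; omega)
    simp only [factor, List.getElem_map, List.getElem_range] at this
    rwa [show i + (x - i) = x by omega, show i + (x - i + p) = x + p by omega] at this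
  · rw [length_factor] at hx
    simp only [factor, List.getElem_map, List.getElem_range]
    rw [hrun (i + x) (by omega) (by omega), add_assoc]

theorem IsFactor.exists_eq {x : List (Fin 2)} (hx : IsFactor word x) :
    ∃ i, x = factor i x.length := hx

theorem one_le_leastPeriod {A : Type*} (x : List A) : 1 ≤ leastPeriod x :=
  (isPeriod_leastPeriod x).1

theorem length_le_maxLen {x : List (Fin 2)} (hx : IsFactor word x)
    (hlen : 5 * leastPeriod x ≤ x.length) :
    ∃ m, leastPeriod x = Kcal m ∧ x.length ≤ maxLen m := by
  obtain ⟨i, hi⟩ := hx.exists_eq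
  have hper := isPeriod_leastPeriod x
  generalize leastPeriod x = p at *
  generalize x.length = n at *
  subst hi
  obtain ⟨hp, hrun⟩ := (isPeriod_factor_iff (by omega)).1 hper
  obtain ⟨m, hm, hle⟩ := hrun.le_maxLen hp (by omega)
  exact ⟨m, hm, by omega⟩

theorem exists_factor_maxLen {m : ℕ} (hm : 5 * Kcal m ≤ maxLen m) :
    ∃ x : List (Fin 2), x ≠ [] ∧ IsFactor word x ∧ leastPeriod x = Kcal m ∧
      x.length = maxLen m := by
  obtain ⟨i, j, hrun, hij⟩ := exists_run_maxLen m
  have hK := Kcal_pos m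
  have hfac := isFactor_factor i (maxLen m)
  have hper : IsPeriod (factor i (maxLen m)) (Kcal m) :=
    (isPeriod_factor_iff (by omega)).2 ⟨hK, by rwa [show i + (maxLen m - Kcal m) = j by omega]⟩
  have hle : leastPeriod (factor i (maxLen m)) ≤ Kcal m := Nat.sInf_le hper
  have hlen := length_factor i (maxLen m)
  refine ⟨factor i (maxLen m), fun h0 => ?_, hfac, ?_, hlen⟩
  · rw [h0, List.length_nil] at hlen; omega
  -- A smaller least period would only raise the exponent, so it would be some `Kcal m'` with
  -- `maxLen m ≤ maxLen m'`; monotonicity then gives `Kcal m ≤ Kcal m'`.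
  · obtain ⟨m', hm', hle'⟩ := length_le_maxLen hfac (by omega)
    rw [hlen, maxLen_strictMono.le_iff_le] at hle'
    have := Kcal_strictMono.monotone hle'
    omega

theorem five_mul_le_maxLen_iff (m : ℕ) : 5 * Kcal m ≤ maxLen m ↔ 2 ≤ m := by
  obtain rfl | rfl | ⟨m, rfl⟩ : m = 0 ∨ m = 1 ∨ ∃ k, m = k + 2 := by
    rcases m with _ | _ | k
    · simp
    · simp
    · exact Or.inr (Or.inr ⟨k, rfl⟩)
  · simp [maxLen, Kcal_zero, Ksum]
  · simp [maxLen, Kcal_zero, Kcal_one, Ksum]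
  · have := Ksum_le m
    have := Kcal_succ_eq m
    have := Kcal_add_two m
    simp only [maxLen, Ksum]
    omega

theorem isMaxLength_iff (n p : ℕ) :
    (IsMaxLength word n p ∧ 5 * p ≤ n) ↔ ∃ m, 2 ≤ m ∧ n = maxLen m ∧ p = Kcal m := by
  constructor
  · rintro ⟨⟨⟨x, hx0, hx, rfl, rfl⟩, hub⟩, hle⟩
    obtain ⟨m, hm, hlen⟩ := length_le_maxLen hx hle
    have hm5 : 5 * Kcal m ≤ maxLen m := by omega
    obtain ⟨y, hy0, hy, hyp, hyl⟩ := exists_factor_maxLen hm5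
    have := hub ⟨y, hy0, hy, hyp.trans hm.symm, hyl⟩
    exact ⟨m, (five_mul_le_maxLen_iff m).1 hm5, by omega, hm⟩
  · rintro ⟨m, hm, rfl, rfl⟩
    have hm5 := (five_mul_le_maxLen_iff m).2 hm
    refine ⟨⟨exists_factor_maxLen hm5, ?_⟩, hm5⟩
    rintro n ⟨x, -, hx, hxp, rfl⟩
    by_contra hlt
    obtain ⟨m', hm', hlen⟩ := length_le_maxLen hx (by omega)
    rw [hxp] at hm'
    rw [← Kcal_strictMono.injective hm'] at hlen
    omega

/-! ### The critical exponent -/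

/-- The difference `δ` satisfies `δ ↦ 2 - (√3 - 1)δ`, which maps `[0, 2]` into itself as `0 ≤ √3 - 1
≤ 1`. -/
theorem Kcal_sub_mem (m : ℕ) :
    0 ≤ (Kcal m : ℝ) - √3 * Ksum m ∧ (Kcal m : ℝ) - √3 * Ksum m ≤ 2 := by
  have hsq : √3 * √3 = 3 := Real.mul_self_sqrt (by norm_num)
  have h1 : 1 ≤ √3 := Real.one_le_sqrt.2 (by norm_num)
  have h2 : √3 ≤ 2 := Real.sqrt_le_iff.2 (by norm_num)
  induction m with
  | zero => simp [Kcal_zero, Ksum]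
  | succ m ih =>
    have e : (Kcal (m + 1) : ℝ) - √3 * Ksum (m + 1) =
        2 - (√3 - 1) * (Kcal m - √3 * Ksum m) := by
      rw [Kcal_succ_eq, Ksum]
      push_cast
      linear_combination (-(Ksum m : ℝ)) * hsq
    rw [e]
    generalize (Kcal m : ℝ) - √3 * Ksum m = δ at ih
    obtain ⟨h3, h4⟩ := ih
    constructor <;> nlinarith

theorem critical_eq : (2 * √3 + 12) / 3 = 4 + 2 / √3 := by
  have hsq : √3 * √3 = 3 := Real.mul_self_sqrt (by norm_num)
  have h0 : √3 ≠ 0 := by positivity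
  field_simp
  linarith

theorem maxLen_div_le (m : ℕ) : (maxLen m : ℝ) / Kcal m ≤ 4 + 2 / √3 := by
  have h0 : 0 < √3 := by positivity
  have hK : (0 : ℝ) < Kcal m := by exact_mod_cast Kcal_pos m
  have h1 := (Kcal_sub_mem m).1
  have h2 : (Ksum m : ℝ) ≤ Kcal m / √3 := by
    rw [le_div_iff₀ h0]; linarith
  rw [div_le_iff₀ hK, maxLen]
  push_cast
  have : (4 + 2 / √3) * (Kcal m : ℝ) = 4 * Kcal m + 2 * (Kcal m / √3) := by ring
  linarith

theorem le_maxLen_div (m : ℕ) : 4 + 2 / √3 - 4 / Kcal m ≤ (maxLen m : ℝ) / Kcal m := by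
  have h0 : 0 < √3 := by positivity
  have h1 : 1 ≤ √3 := Real.one_le_sqrt.2 (by norm_num)
  have hK : (0 : ℝ) < Kcal m := by exact_mod_cast Kcal_pos m
  have h2 := (Kcal_sub_mem m).2
  have h3 : (Kcal m : ℝ) / √3 ≤ Ksum m + 2 := by
    rw [div_le_iff₀ h0]; nlinarith
  rw [le_div_iff₀ hK, maxLen]
  push_cast
  have : (4 + 2 / √3 - 4 / (Kcal m : ℝ)) * (Kcal m : ℝ) =
      4 * Kcal m + 2 * (Kcal m / √3) - 4 := by field_simp
  linarith

theorem isCriticalExponent_word : IsCriticalExponent word (4 + 2 / √3) := by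
  constructor
  · rintro r ⟨x, -, hx, rfl⟩
    have hp : (0 : ℝ) < leastPeriod x := by exact_mod_cast one_le_leastPeriod x
    by_cases hle : 5 * leastPeriod x ≤ x.length
    · obtain ⟨m, hm, hlen⟩ := length_le_maxLen hx hle
      refine le_trans ?_ (maxLen_div_le m)
      rw [exponent, hm]
      gcongr
    -- Exponents below 5 are harmless, because `2 / √3 ≥ 1`.
    · have h2 : √3 ≤ 2 := Real.sqrt_le_iff.2 (by norm_num)
      have h3 : (1 : ℝ) ≤ 2 / √3 := by rwa [le_div_iff₀ (by positivity), one_mul]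
      have h4 : (x.length : ℝ) ≤ 5 * leastPeriod x := by exact_mod_cast (not_le.1 hle).le
      rw [exponent, div_le_iff₀ hp]
      nlinarith
  · intro b hb
    refine le_of_forall_pos_sub_le fun ε hε => ?_
    obtain ⟨m, hm⟩ := exists_nat_gt (4 / ε)
    have hm5 := (five_mul_le_maxLen_iff (m + 2)).2 (by omega)
    obtain ⟨x, hx0, hx, hxp, hxl⟩ := exists_factor_maxLen hm5
    have hxb := hb ⟨x, hx0, hx, rfl⟩
    rw [exponent, hxp, hxl] at hxb
    have hKm : (m : ℝ) < Kcal (m + 2) := by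
      have := lt_length_K (m + 2)
      exact_mod_cast (show m < Kcal (m + 2) by rw [Kcal]; omega)
    have hK : (0 : ℝ) < Kcal (m + 2) := by exact_mod_cast Kcal_pos (m + 2)
    have : 4 / (Kcal (m + 2) : ℝ) ≤ ε := by
      rw [div_le_iff₀ hK]
      rw [div_lt_iff₀ hε] at hm
      nlinarith
    have := le_maxLen_div (m + 2)
    linarith

/-! ### Values of digit words -/

theorem length_pow (u : List ℕ) (i : ℕ) : (pow u i).length = i * u.length := by
  simp [pow]

theorem pow_succ_eq (u : List ℕ) (i : ℕ) : pow u (i + 1) = u ++ pow u i := by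
  simp [pow, List.replicate_succ]

theorem val_zeros (i : ℕ) (t : List ℕ) : val (pow [0, 0] i ++ t) = val t := by
  induction i with
  | zero => simp [pow]
  | succ i ih => simp [pow_succ_eq, val, ih]

theorem val_period (i : ℕ) (t : List ℕ) (ht : val t = 0) :
    val ([1, 0] ++ pow [0, 0] i ++ t) = Kcal (2 * i + t.length + 1) := by
  have := val_zeros i t
  simp [val, length_pow, this, ht]
  congr 1
  omega

/-- Prepending `01` to a tail of length `L` works because `2𝒦_{L+1} + 2𝒦_L = 𝒦_{L+2}` is exactly the
growth of the right side. -/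
theorem Kcal_add_val {t : List ℕ} (ht : Kcal t.length + val t = 2 * Ksum t.length) (i : ℕ) :
    Kcal (2 * i + t.length) + val (pow [0, 1] i ++ t) = 2 * Ksum (2 * i + t.length) := by
  induction i with
  | zero => simpa [pow] using ht
  | succ i ih =>
    have e : (pow [0, 1] i ++ t).length = 2 * i + t.length := by
      rw [List.length_append, length_pow]; simp [mul_comm]
    have hK := Kcal_add_two (2 * i + t.length)
    rw [pow_succ_eq, show 2 * (i + 1) + t.length = 2 * i + t.length + 2 by omega]
    simp only [List.cons_append, List.nil_append, val, e, Ksum]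
    omega

theorem val_maxLen {t : List ℕ} (ht : Kcal t.length + val t = 2 * Ksum t.length) (i : ℕ) :
    val ([1, 2, 1] ++ pow [0, 1] i ++ t) = maxLen (2 * i + t.length + 1) := by
  have e : (pow [0, 1] i ++ t).length = 2 * i + t.length := by
    rw [List.length_append, length_pow]; simp [mul_comm]
  have hV := Kcal_add_val ht i
  have hK : Kcal (2 * i + t.length + 1 + 1) = _ := Kcal_add_two (2 * i + t.length)
  simp only [List.cons_append, List.nil_append, val, List.length_cons, e,
    maxLen, Ksum]
  omega

theorem Kcal_two : Kcal 2 = 8 := rfl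

theorem exists_maxLen_iff (n p : ℕ) :
    (∃ m, 2 ≤ m ∧ n = maxLen m ∧ p = Kcal m) ↔
      (n = val [1, 2, 0, 2] ∧ p = val [1, 0, 0]) ∨
      (∃ i : ℕ, n = val ([1, 2, 1] ++ pow [0, 1] i ++ [0, 0]) ∧
        p = val ([1, 0] ++ pow [0, 0] i ++ [0, 0])) ∨
      (∃ i : ℕ, n = val ([1, 2, 1] ++ pow [0, 1] i ++ [0, 0, 2]) ∧
        p = val ([1, 0] ++ pow [0, 0] i ++ [0, 0, 0])) := by
  have hodd : ∀ i, val ([1, 2, 1] ++ pow [0, 1] i ++ [0, 0]) = maxLen (2 * i + 2 + 1) :=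
    val_maxLen (by simp [val, Ksum, Kcal_zero, Kcal_one, Kcal_two])
  have heven : ∀ i, val ([1, 2, 1] ++ pow [0, 1] i ++ [0, 0, 2]) = maxLen (2 * i + 3 + 1) :=
    val_maxLen (by simp [val, Ksum, Kcal_zero, Kcal_one, Kcal_two, Kcal_add_two 1])
  have hodd' : ∀ i, val ([1, 0] ++ pow [0, 0] i ++ [0, 0]) = Kcal (2 * i + 2 + 1) :=
    fun i => val_period i _ (by simp [val])
  have heven' : ∀ i, val ([1, 0] ++ pow [0, 0] i ++ [0, 0, 0]) = Kcal (2 * i + 3 + 1) :=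
    fun i => val_period i _ (by simp [val])
  have htwo : val [1, 2, 0, 2] = maxLen 2 := by
    simp [val, maxLen, Ksum, Kcal_zero, Kcal_one, Kcal_two, Kcal_add_two 1]
  have htwo' : val [1, 0, 0] = Kcal 2 := by simp [val]
  simp only [hodd, heven, hodd', heven', htwo, htwo']
  constructor
  · rintro ⟨m, hm, rfl, rfl⟩
    rcases Nat.even_or_odd' m with ⟨k, rfl | rfl⟩
    · rcases hm.eq_or_lt with h2 | h2
      · exact Or.inl (by rw [← h2]; exact ⟨rfl, rfl⟩)
      · refine Or.inr (Or.inr ⟨k - 2, ?_⟩)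
        rw [show 2 * (k - 2) + 3 + 1 = 2 * k by omega]
        exact ⟨rfl, rfl⟩
    · refine Or.inr (Or.inl ⟨k - 1, ?_⟩)
      rw [show 2 * (k - 1) + 2 + 1 = 2 * k + 1 by omega]
      exact ⟨rfl, rfl⟩
  · rintro (⟨rfl, rfl⟩ | ⟨i, rfl, rfl⟩ | ⟨i, rfl, rfl⟩)
    exacts [⟨2, le_rfl, rfl, rfl⟩, ⟨_, by omega, rfl, rfl⟩, ⟨_, by omega, rfl, rfl⟩]

end Kimberling

theorem theorem11 :
    Kimberling.IsCriticalExponent Kimberling.word ((2 * Real.sqrt 3 + 12) / 3) ∧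
    ∀ n p : ℕ,
      (Kimberling.IsMaxLength Kimberling.word n p ∧ 5 * p ≤ n) ↔
        (n = Kimberling.val [1, 2, 0, 2] ∧ p = Kimberling.val [1, 0, 0]) ∨
        (∃ i : ℕ,
          n = Kimberling.val ([1, 2, 1] ++ Kimberling.pow [0, 1] i ++ [0, 0]) ∧
          p = Kimberling.val ([1, 0] ++ Kimberling.pow [0, 0] i ++ [0, 0])) ∨
        (∃ i : ℕ,
          n = Kimberling.val ([1, 2, 1] ++ Kimberling.pow [0, 1] i ++ [0, 0, 2]) ∧
          p = Kimberling.val ([1, 0] ++ Kimberling.pow [0, 0] i ++ [0, 0, 0])) := by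
  refine ⟨?_, fun n p => ?_⟩
  · rw [Kimberling.critical_eq]
    exact Kimberling.isCriticalExponent_word
  · rw [Kimberling.isMaxLength_iff, Kimberling.exists_maxLen_iff]
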